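/- For $A,B\subseteq\mathbb N$ write $A\le_{\mathrm{lex}}B$ if $A=B$ or the least element of the symmetric difference $A\mathbin{\triangle}B$ lies in $B$; write $A\subset^* B$ if $A\setminus B$ is finite and $B\setminus A$ is infinite. A set $A\subseteq\mathbb N$ is left-r.e. if it is the pointwise limit of a uniformly recursive sequence of sets $A_0\le_{\mathrm{lex}}A_1\le_{\mathrm{lex}}\cdots$. A left-r.e. numbering is a map $e\mapsto\alpha_e$ from $\mathbb N$ to sets of natural numbers for which there are sets $\alpha_{e,s}$, with $n\in\alpha_{e,s}$ decidable uniformly in $e,s,n$, such that $\alpha_{e,s}\le_{\mathrm{lex}}\alpha_{e,s+1}$ for all $e,s$ and $\alpha_e=\lim_{s}\alpha_{e,s}$ pointwise; it is universal if every left-r.e. set is some $\alpha_e$. A class $\mathcal C$ of sets of natural numbers can be made into itself if there is a universal left-r.e. numbering $\beta$ with $\{e:\beta_e\in\mathcal C\}\in\mathcal C$. A left-r.e. set $A$ is minimal if $\emptyset\subset^*A$ and there is no left-r.e. set $E$ with $\emptyset\subset^*E\subset^*A$; a left-r.e. set $B$ is maximal if $B\subset^*\mathbb N$ and there is no left-r.e.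 set $E$ with $B\subset^*E\subset^*\mathbb N$. Theorem. (1) There is a minimal left-r.e. set $A$ such that $\{A\}$ can be made into itself. (2) There is no maximal left-r.e. set $B$ such that $\{B\}$ can be made into itself. (3) No maximal left-r.e. set is disjoint from an infinite recursive set. -/

import Mathlib

/-- The lexicographic order on sets of natural numbers: `A = B`, or the least element of the
symmetric difference belongs to `B`. -/
def LexLE (A B : Set ℕ) : Prop :=
  A = B ∨ ∃ x, IsLeast (symmDiff A B) x ∧ x ∈ B

/-- `A` is the pointwise limit of the sequence of sets `S 0, S 1, …`. -/
def IsPointwiseLimit (S : ℕ → Set ℕ) (A : Set ℕ) : Prop :=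
  ∀ n, ∀ᶠ s in Filter.atTop, (n ∈ S s ↔ n ∈ A)

/-- `A` is left-r.e.: it is the limit of a uniformly recursive sequence of sets that is
increasing in the lexicographic order. -/
def IsLeftRE (A : Set ℕ) : Prop :=
  ∃ S : ℕ → Set ℕ,
    ComputablePred (fun p : ℕ × ℕ => p.2 ∈ S p.1) ∧
    (∀ s, LexLE (S s) (S (s + 1))) ∧
    IsPointwiseLimit S A

/-- `α` is a left-r.e. numbering: `α e` is the limit in `s` of sets `S e s`, uniformly recursive
in `e` and `s`, and lexicographically increasing in `s`. -/
def IsLeftRENumbering (α : ℕ → Set ℕ) : Prop :=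
  ∃ S : ℕ → ℕ → Set ℕ,
    ComputablePred (fun p : ℕ × ℕ × ℕ => p.2.2 ∈ S p.1 p.2.1) ∧
    (∀ e s, LexLE (S e s) (S e (s + 1))) ∧
    (∀ e, IsPointwiseLimit (S e) (α e))

/-- A left-r.e. numbering is universal if its range includes all left-r.e. sets. -/
def IsUniversalLeftRENumbering (α : ℕ → Set ℕ) : Prop :=
  IsLeftRENumbering α ∧ ∀ A, IsLeftRE A → ∃ e, α e = A

/-- The class `C` can be made into itself: the index set of `C` in some universal left-r.e.
numbering is a member of `C`. -/
def CanBeMadeIntoItself (C : Set (Set ℕ)) : Prop :=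
  ∃ β : ℕ → Set ℕ, IsUniversalLeftRENumbering β ∧ {e | β e ∈ C} ∈ C

/-- `A ⊂* B`: almost all elements of `A` are in `B`, and `B \ A` is infinite. -/
def AlmostSSubset (A B : Set ℕ) : Prop :=
  (A \ B).Finite ∧ (B \ A).Infinite

/-- `A` is a minimal left-r.e. set. -/
def IsMinimalLeftRE (A : Set ℕ) : Prop :=
  IsLeftRE A ∧ AlmostSSubset ∅ A ∧
    ¬ ∃ E, IsLeftRE E ∧ AlmostSSubset ∅ E ∧ AlmostSSubset E A

/-- `B` is a maximal left-r.e. set. -/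
def IsMaximalLeftRE (B : Set ℕ) : Prop :=
  IsLeftRE B ∧ AlmostSSubset B Set.univ ∧
    ¬ ∃ E, IsLeftRE E ∧ AlmostSSubset B E ∧ AlmostSSubset E Set.univ

/-! A set is handled through the integers `prefixValue A m`, the binary truncations of the real with
expansion `A`. Lexicographic order becomes an inequality of truncations, so replacing an element by
a smaller one moves a set up.

(1) Fix the universal numbering `leftSet`. The minimal set has exactly one element in each interval
from `level n` to `level (n+1)`. Put `m = level n`. The approximations to the reals of index at most
`n`, rounded up to multiples of `2^-m`, increase only finitely often. Each increase lowers the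
`n`-th element and lifts the next bound above the stage of that increase. Let `T` be the last such
stage. An infinite `leftSet e` with `e ≤ n` has an element in `[m, T)`, since otherwise its rounded
value would increase after `T` (`exists_mem_leftSet_lt_settlingStage`). If `leftSet e` is almost
contained in the minimal set, that element can only be the `n`-th one when `n` is large
(`chosen_mem_leftSet`), so almost all of the minimal set lies in `leftSet e`.

Lifting the bounds also ensures that a number `x` present at a stage `≥ x` never returns once it has
left. The set with even index `x` can therefore copy the minimal set and jump to all of `ℕ` when `x`
leaves. Odd indices enumerate the other left-r.e. sets, each with a guess of where it differs from
the minimal set.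

(3) If `B` misses an infinite recursive `R`, adding half of `R` to `B` gives a left-r.e. set
strictly between `B` and `ℕ`. (2) The indices of sets seen to exceed `B` form an infinite r.e. set,
which has an infinite recursive subset. If the index set of `B` were `B`, this would contradict (3).
-/

namespace ComputablePred

/-! ### Closure properties of computable predicates. -/

variable {α β : Type*} [Primcodable α] [Primcodable β]

theorem comp {p : β → Prop} {f : α → β} (hp : ComputablePred p) (hf : Computable f) :
    ComputablePred fun a => p (f a) := by
  obtain ⟨_, hp⟩ := hp
  exact ⟨inferInstance, hp.comp hf⟩

theorem and {p q : α → Prop} (hp : ComputablePred p) (hq : ComputablePred q) :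
    ComputablePred fun a => p a ∧ q a := by
  obtain ⟨_, hp⟩ := hp
  obtain ⟨_, hq⟩ := hq
  exact ⟨inferInstance, (Primrec.and.to_comp.comp hp hq).of_eq fun a => by simp⟩

theorem or {p q : α → Prop} (hp : ComputablePred p) (hq : ComputablePred q) :
    ComputablePred fun a => p a ∨ q a := by
  obtain ⟨_, hp⟩ := hp
  obtain ⟨_, hq⟩ := hq
  exact ⟨inferInstance, (Primrec.or.to_comp.comp hp hq).of_eq fun a => by simp⟩

theorem nat_eq {f g : α → ℕ} (hf : Computable f) (hg : Computable g) :
    ComputablePred fun a => f a = g a :=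
  ⟨inferInstance, (Primrec.eq.decide.to_comp (α := ℕ) (β := ℕ)).comp hf hg⟩

theorem nat_lt {f g : α → ℕ} (hf : Computable f) (hg : Computable g) :
    ComputablePred fun a => f a < g a :=
  ⟨inferInstance, (Primrec.nat_lt.decide.to_comp (α := ℕ) (β := ℕ)).comp hf hg⟩

theorem nat_le {f g : α → ℕ} (hf : Computable f) (hg : Computable g) :
    ComputablePred fun a => f a ≤ g a :=
  ⟨inferInstance, (Primrec.nat_le.decide.to_comp (α := ℕ) (β := ℕ)).comp hf hg⟩

open Classical in
theorem ite_value {γ : Type*} [Primcodable γ] {p : α → Prop} {f g : α → γ} (hp : ComputablePred p)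
    (hf : Computable f) (hg : Computable g) : Computable fun a => if p a then f a else g a :=
  (Computable.cond hp.decide hf hg).of_eq fun a => by by_cases h : p a <;> simp [h]

theorem ite_prop {p q r : α → Prop} (hp : ComputablePred p) (hq : ComputablePred q)
    (hr : ComputablePred r) : ComputablePred fun a => (p a ∧ q a) ∨ (¬ p a ∧ r a) :=
  (hp.and hq).or (hp.not.and hr)

theorem exists_lt {p : α → ℕ → Prop} {b : α → ℕ} (hp : ComputablePred fun x : α × ℕ => p x.1 x.2)
    (hb : Computable b) : ComputablePred fun a => ∃ i < b a, p a i := by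
  classical
  have h : Computable fun a => Nat.rec (motive := fun _ => Bool) false
      (fun i c => c || decide (p a i)) (b a) :=
    Computable.nat_rec (h := fun a (x : ℕ × Bool) => x.2 || decide (p a x.1)) hb
      (Computable.const false)
      (Primrec.or.to_comp.comp (Computable.snd.comp Computable.snd)
        (hp.decide.comp (Computable.pair Computable.fst (Computable.fst.comp Computable.snd))))
  have key : ∀ a n, Nat.rec (motive := fun _ => Bool) false (fun i c => c || decide (p a i)) n =
      decide (∃ i < n, p a i) := fun a n => by
    induction n with
    | zero => simp
    | succ n ih =>
      simp only [ih, Nat.lt_succ_iff_lt_or_eq, or_and_right, exists_or, exists_eq_left,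
        Bool.decide_or]
  exact ⟨fun _ => Classical.propDecidable _, h.of_eq fun a => (key a _).trans (by congr)⟩

/-- Unbounded search for a witness that is known to exist. -/
theorem exists_find {p : α → ℕ → Prop} (hp : ComputablePred fun x : α × ℕ => p x.1 x.2)
    (h : ∀ a, ∃ n, p a n) :
    ∃ f : α → ℕ, Computable f ∧ (∀ a, p a (f a)) ∧ ∀ a n, p a n → f a ≤ n := by
  classical
  exact ⟨fun a => Nat.find (h a), Computable.find hp h, fun a => Nat.find_spec (h a),
    fun a n hn => Nat.find_min' (h a) hn⟩

end ComputablePred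

/-! ### Binary truncations, the lexicographic order and limits. -/

open Classical in
/-- The number whose binary digits are the first `m` values of the characteristic function
of `A`, the value at `0` being the leading digit. -/
noncomputable def prefixValue (A : Set ℕ) : ℕ → ℕ
  | 0 => 0
  | m + 1 => 2 * prefixValue A m + if m ∈ A then 1 else 0

namespace prefixValue

variable {A B : Set ℕ}

theorem succ_of_mem {m : ℕ} (h : m ∈ A) : prefixValue A (m + 1) = 2 * prefixValue A m + 1 := by
  simp [prefixValue, h]

theorem succ_of_notMem {m : ℕ} (h : m ∉ A) : prefixValue A (m + 1) = 2 * prefixValue A m := by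
  simp [prefixValue, h]

theorem lt_two_pow (A : Set ℕ) (m : ℕ) : prefixValue A m < 2 ^ m := by
  induction m with
  | zero => simp [prefixValue]
  | succ m ih =>
    rw [prefixValue, pow_succ]
    split_ifs <;> omega

theorem odd_iff (x : ℕ) : prefixValue A (x + 1) % 2 = 1 ↔ x ∈ A := by
  rw [prefixValue]
  split_ifs with h <;> simp [h]

theorem div_two (A : Set ℕ) (m : ℕ) : prefixValue A (m + 1) / 2 = prefixValue A m := by
  rw [prefixValue]
  split_ifs <;> omega

theorem div_two_pow (A : Set ℕ) (m d : ℕ) :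
    prefixValue A (m + d) / 2 ^ d = prefixValue A m := by
  induction d with
  | zero => simp
  | succ d ih => rw [pow_succ', ← Nat.div_div_eq_div_mul, ← add_assoc, div_two, ih]

theorem mul_two_pow_le (A : Set ℕ) (m d : ℕ) :
    prefixValue A m * 2 ^ d ≤ prefixValue A (m + d) := by
  rw [← div_two_pow A m d]
  exact Nat.div_mul_le_self _ _

theorem mul_two_pow_eq {m d : ℕ} (h : ∀ x, m ≤ x → x < m + d → x ∉ A) :
    prefixValue A (m + d) = prefixValue A m * 2 ^ d := by
  induction d with
  | zero => simp
  | succ d ih =>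
    rw [← add_assoc, succ_of_notMem (h _ (by omega) (by omega)),
      ih fun x h1 h2 => h x h1 (by omega)]
    ring

theorem eq_iff {m : ℕ} :
    prefixValue A m = prefixValue B m ↔ ∀ x < m, (x ∈ A ↔ x ∈ B) := by
  induction m with
  | zero => simp [prefixValue]
  | succ m ih =>
    constructor
    · intro h x hx
      rcases Nat.lt_succ_iff_lt_or_eq.1 hx with h' | rfl
      · exact ih.1 (by rw [← div_two A, ← div_two B, h]) x h'
      · rw [← odd_iff, h, odd_iff]
    · intro h
      rw [prefixValue, prefixValue, ih.2 fun x hx => h x (by omega)]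
      by_cases hm : m ∈ A
      · simp [hm, (h m (by omega)).1 hm]
      · simp [hm, mt (h m (by omega)).2 hm]

theorem ext (h : ∀ m, prefixValue A m = prefixValue B m) : A = B :=
  Set.ext fun x => eq_iff.1 (h (x + 1)) x (by omega)

theorem le_of_prefix_lt {m n : ℕ} (hmn : m ≤ n) (h : prefixValue A m < prefixValue B m) :
    prefixValue A n < prefixValue B n := by
  obtain ⟨d, rfl⟩ := Nat.exists_eq_add_of_le hmn
  rw [← div_two_pow A m d, ← div_two_pow B m d] at h
  exact lt_of_not_ge fun h' => absurd (Nat.div_le_div_right (c := 2 ^ d) h') (by omega)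

/-- For `s ≤ m` the left side is the prefix of length `s` padded with zeros; for `m ≤ s` both sides
are the same prefix. -/
theorem mul_two_pow_div_le (A : Set ℕ) (s m : ℕ) :
    prefixValue A s * 2 ^ m / 2 ^ s ≤ prefixValue A m := by
  rcases le_total s m with h | h
  · obtain ⟨d, rfl⟩ := Nat.exists_eq_add_of_le h
    rw [pow_add, mul_comm (2 ^ s), ← mul_assoc, Nat.mul_div_cancel _ (by positivity)]
    exact mul_two_pow_le A s d
  · obtain ⟨d, rfl⟩ := Nat.exists_eq_add_of_le h
    rw [pow_add, mul_comm (2 ^ m), Nat.mul_div_mul_right _ _ (by positivity), div_two_pow]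

/-- Cross-multiplied comparison of the truncations at `T` and at `m`: zero digits in between add
nothing. -/
theorem mul_le_of_forall_notMem {m T : ℕ} (h : ∀ x, m ≤ x → x < T → x ∉ A) :
    prefixValue A T * 2 ^ m ≤ prefixValue A m * 2 ^ T := by
  rcases le_total T m with h' | h'
  · obtain ⟨d, rfl⟩ := Nat.exists_eq_add_of_le h'
    calc _ = prefixValue A T * 2 ^ d * 2 ^ T := by ring
      _ ≤ _ := Nat.mul_le_mul_right _ (mul_two_pow_le A T d)
  · obtain ⟨d, rfl⟩ := Nat.exists_eq_add_of_le h'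
    rw [mul_two_pow_eq h]
    exact le_of_eq (by ring)

theorem lt_of_mem {m y : ℕ} (hmy : m ≤ y) (hy : y ∈ A) :
    prefixValue A m * 2 ^ (y + 1) < prefixValue A (y + 1) * 2 ^ m := by
  obtain ⟨d, rfl⟩ := Nat.exists_eq_add_of_le hmy
  rw [succ_of_mem hy]
  have h := Nat.mul_le_mul_right (2 ^ m) (mul_two_pow_le A m d)
  have h2 : 0 < 2 ^ m := by positivity
  calc _ = 2 * (prefixValue A m * 2 ^ d * 2 ^ m) := by ring
    _ < 2 * (prefixValue A (m + d) * 2 ^ m) + 2 ^ m := by omega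
    _ = _ := by ring

theorem computable {γ : Type*} [Primcodable γ] {S : γ → Set ℕ} {f : γ → ℕ}
    (hS : ComputablePred fun p : γ × ℕ => p.2 ∈ S p.1) (hf : Computable f) :
    Computable fun a => prefixValue (S a) (f a) := by
  classical
  have h : Computable fun a => Nat.rec (motive := fun _ => ℕ) 0
      (fun i c => 2 * c + if i ∈ S a then 1 else 0) (f a) :=
    Computable.nat_rec (h := fun a (x : ℕ × ℕ) => 2 * x.2 + if x.1 ∈ S a then 1 else 0) hf
      (Computable.const 0)
      (Primrec.nat_add.to_comp.comp
        (Primrec.nat_mul.to_comp.comp (Computable.const 2) (Computable.snd.comp Computable.snd))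
        ((ComputablePred.ite_value (hS.comp (Computable.pair Computable.fst
          (Computable.fst.comp Computable.snd))) (Computable.const 1) (Computable.const 0)).of_eq
          fun a => by congr))
  refine h.of_eq fun a => ?_
  generalize f a = n
  induction n with
  | zero => rfl
  | succ n ih =>
    simp only [prefixValue, ih]

end prefixValue

/-- At the least difference the prefixes before it agree, and the next digit decides the comparison
for all longer prefixes. Transitivity, antisymmetry and passage to limits thus reduce to the order
on `ℕ`. -/
theorem lexLE_iff {A B : Set ℕ} : LexLE A B ↔ ∀ m, prefixValue A m ≤ prefixValue B m := by
  constructor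
  · rintro (rfl | ⟨x, hx, hxB⟩) m
    · exact le_rfl
    · have hx' : x ∉ A := fun h => by simpa [Set.mem_symmDiff, h, hxB] using hx.1
      have hlow : ∀ y < x, (y ∈ A ↔ y ∈ B) := fun y hy => by
        by_contra h
        have : y ∈ symmDiff A B := by rw [Set.mem_symmDiff]; tauto
        exact absurd (hx.2 this) (by omega)
      rcases Nat.lt_or_ge x m with h | h
      · refine (prefixValue.le_of_prefix_lt (m := x + 1) h ?_).le
        rw [prefixValue.succ_of_mem hxB, prefixValue.succ_of_notMem hx', prefixValue.eq_iff.2 hlow]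
        omega
      · exact (prefixValue.eq_iff.2 fun y hy => hlow y (by omega)).le
  · intro h
    by_cases hAB : A = B
    · exact Or.inl hAB
    · have hne : ∃ x, x ∈ symmDiff A B := by
        by_contra hne
        push Not at hne
        exact hAB (Set.ext fun x => by have := hne x; rw [Set.mem_symmDiff] at this; tauto)
      classical
      have hmin := Nat.find_spec hne
      refine Or.inr ⟨Nat.find hne, ⟨hmin, fun y hy => Nat.find_min' hne hy⟩, ?_⟩
      by_contra hB
      have hA : Nat.find hne ∈ A := by rw [Set.mem_symmDiff] at hmin; tauto
      have heq : prefixValue A (Nat.find hne) = prefixValue B (Nat.find hne) :=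
        prefixValue.eq_iff.2 fun x hx => by
          have := Nat.find_min hne hx; rw [Set.mem_symmDiff] at this; tauto
      have := h (Nat.find hne + 1)
      rw [prefixValue.succ_of_mem hA, prefixValue.succ_of_notMem hB] at this
      omega

namespace LexLE

variable {A B C : Set ℕ}

theorem refl (A : Set ℕ) : LexLE A A := Or.inl rfl

theorem trans (h₁ : LexLE A B) (h₂ : LexLE B C) : LexLE A C :=
  lexLE_iff.2 fun m => (lexLE_iff.1 h₁ m).trans (lexLE_iff.1 h₂ m)

theorem antisymm (h₁ : LexLE A B) (h₂ : LexLE B A) : A = B :=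
  prefixValue.ext fun m => (lexLE_iff.1 h₁ m).antisymm (lexLE_iff.1 h₂ m)

theorem of_subset (h : A ⊆ B) : LexLE A B := by
  refine lexLE_iff.2 fun m => ?_
  induction m with
  | zero => exact le_rfl
  | succ m ih =>
    by_cases hA : m ∈ A
    · rw [prefixValue.succ_of_mem hA, prefixValue.succ_of_mem (h hA)]; omega
    · rw [prefixValue.succ_of_notMem hA, prefixValue]; omega

theorem of_le {S : ℕ → Set ℕ} (h : ∀ s, LexLE (S s) (S (s + 1))) {s t : ℕ} (hst : s ≤ t) :
    LexLE (S s) (S t) := by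
  induction t, hst using Nat.le_induction with
  | base => exact refl _
  | succ t _ ih => exact ih.trans (h t)

end LexLE

theorem exists_eventually_eq_of_monotone {f : ℕ → ℕ} (hf : Monotone f) {b : ℕ}
    (hb : ∀ s, f s ≤ b) : ∃ N, ∀ s ≥ N, f s = f N := by
  obtain ⟨_, ⟨N, rfl⟩, hN⟩ := Set.exists_max_image (Set.range f) id
    ((Set.finite_Iic b).subset (by rintro _ ⟨s, rfl⟩; exact hb s)) ⟨_, 0, rfl⟩
  exact ⟨N, fun s hs => (hN _ ⟨s, rfl⟩).antisymm (hf hs)⟩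

namespace IsPointwiseLimit

variable {S : ℕ → Set ℕ} {A : Set ℕ}

theorem eventually_prefixValue (h : IsPointwiseLimit S A) (m : ℕ) :
    ∀ᶠ s in Filter.atTop, prefixValue (S s) m = prefixValue A m := by
  have : ∀ᶠ s in Filter.atTop, ∀ x ∈ Set.Iio m, (x ∈ S s ↔ x ∈ A) :=
    (Filter.eventually_all_finite (Set.finite_Iio m)).2 fun x _ => h x
  filter_upwards [this] with s hs
  exact prefixValue.eq_iff.2 hs

theorem lexLE (h : IsPointwiseLimit S A) (hS : ∀ s, LexLE (S s) (S (s + 1))) (s : ℕ) :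
    LexLE (S s) A := by
  refine lexLE_iff.2 fun m => ?_
  obtain ⟨t, ht, hst⟩ := ((h.eventually_prefixValue m).and (Filter.eventually_ge_atTop s)).exists
  rw [← ht]
  exact lexLE_iff.1 (LexLE.of_le hS hst) m

theorem lexLE_of_forall (h : IsPointwiseLimit S A) {B : Set ℕ} (hS : ∀ s, LexLE (S s) B) :
    LexLE A B := by
  refine lexLE_iff.2 fun m => ?_
  obtain ⟨t, ht⟩ := (h.eventually_prefixValue m).exists
  rw [← ht]
  exact lexLE_iff.1 (hS t) m

theorem unique (h : IsPointwiseLimit S A) {B : Set ℕ} (h' : IsPointwiseLimit S B) : A = B :=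
  Set.ext fun x => by
    obtain ⟨s, h1, h2⟩ := ((h x).and (h' x)).exists
    rw [← h1, h2]

theorem congr' (h : IsPointwiseLimit S A) {T : ℕ → Set ℕ}
    (hT : ∀ᶠ s in Filter.atTop, T s = S s) : IsPointwiseLimit T A := fun x => by
  filter_upwards [h x, hT] with s h1 h2
  rw [h2, h1]

theorem const (A : Set ℕ) : IsPointwiseLimit (fun _ => A) A :=
  fun _ => Filter.Eventually.of_forall fun _ => Iff.rfl

end IsPointwiseLimit

/-- Each prefix value is monotone in the stage and bounded by `2 ^ m`, hence eventually constant. -/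
theorem exists_isPointwiseLimit {S : ℕ → Set ℕ} (hS : ∀ s, LexLE (S s) (S (s + 1))) :
    ∃ A, IsPointwiseLimit S A := by
  have hstab : ∀ m, ∃ N, ∀ s ≥ N, prefixValue (S s) m = prefixValue (S N) m := fun m =>
    exists_eventually_eq_of_monotone
      (monotone_nat_of_le_succ fun s => lexLE_iff.1 (hS s) m)
      (b := 2 ^ m) fun s => (prefixValue.lt_two_pow _ _).le
  choose N hN using hstab
  refine ⟨{x | x ∈ S (N (x + 1))}, fun x => ?_⟩
  filter_upwards [Filter.eventually_ge_atTop (N (x + 1))] with s hs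
  exact prefixValue.eq_iff.1 (hN _ s hs) x (by omega)

/-! ### A universal left-r.e. numbering by dyadic approximations. -/

theorem Primrec.nat_pow : Primrec₂ ((· ^ ·) : ℕ → ℕ → ℕ) :=
  Primrec₂.unpaired'.1 Nat.Primrec.pow

theorem Primrec.nat_rec_of_eq {α : Type*} [Primcodable α] {F : α → ℕ → ℕ} {h : α → ℕ × ℕ → ℕ}
    (hh : Primrec₂ h) (h0 : ∀ a, F a 0 = 0) (hs : ∀ a n, F a (n + 1) = h a (n, F a n)) :
    Primrec₂ F := by
  have hr : Primrec fun p : α × ℕ => Nat.rec (motive := fun _ => ℕ) 0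
      (fun n c => h p.1 (n, c)) p.2 :=
    Primrec.nat_rec' (h := fun p x => h p.1 x) Primrec.snd (Primrec.const 0)
      (hh.comp (Primrec.fst.comp Primrec.fst) Primrec.snd)
  refine hr.of_eq fun ⟨a, n⟩ => ?_
  induction n with
  | zero => exact (h0 a).symm
  | succ n ih => exact (congrArg (fun c => h a (n, c)) ih).trans (hs a n).symm

/-- The finite set whose characteristic function is the binary expansion of `q / 2 ^ s`. -/
def dyadicSet (q s : ℕ) : Set ℕ := {x | q * 2 ^ (x + 1) / 2 ^ s % 2 = 1}

theorem prefixValue_dyadicSet {q s : ℕ} (h : q < 2 ^ s) (m : ℕ) :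
    prefixValue (dyadicSet q s) m = q * 2 ^ m / 2 ^ s := by
  induction m with
  | zero => simp [prefixValue, Nat.div_eq_of_lt h]
  | succ m ih =>
    have h2 : q * 2 ^ (m + 1) / 2 ^ s / 2 = q * 2 ^ m / 2 ^ s := by
      rw [Nat.div_div_eq_div_mul, pow_succ, ← mul_assoc, Nat.mul_div_mul_right _ _ two_pos]
    have h3 : m ∈ dyadicSet q s ↔ q * 2 ^ (m + 1) / 2 ^ s % 2 = 1 := Iff.rfl
    by_cases hm : m ∈ dyadicSet q s
    · rw [prefixValue.succ_of_mem hm, ih]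
      have := h3.1 hm
      omega
    · rw [prefixValue.succ_of_notMem hm, ih]
      have := mt h3.2 hm
      omega

theorem dyadicSet_lexLE_succ {q r s : ℕ} (hr : r < 2 ^ (s + 1)) (h : 2 * q ≤ r) :
    LexLE (dyadicSet q s) (dyadicSet r (s + 1)) := by
  refine lexLE_iff.2 fun m => ?_
  rw [prefixValue_dyadicSet hr, prefixValue_dyadicSet (by rw [pow_succ] at hr; omega),
    ← Nat.mul_div_mul_left _ _ two_pos, ← pow_succ', ← mul_assoc]
  exact Nat.div_le_div_right (Nat.mul_le_mul_right _ h)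

open Nat.Partrec (Code)

/-- At stage `s` coding `(t, k)`, the value after `k` steps of the `e`-th partial recursive function
at `t`, read as a binary expansion of length `t` and padded to length `s + 1`. -/
def stageContribution (e s : ℕ) : ℕ :=
  min ((Code.evaln s.unpair.2 (Denumerable.ofNat Code e) s.unpair.1).getD 0) (2 ^ s.unpair.1 - 1) *
    2 ^ (s + 1 - s.unpair.1)

/-- The `s`-th dyadic approximation, with denominator `2 ^ s`, to the `e`-th left-r.e. real. -/
def leftApprox (e : ℕ) : ℕ → ℕ
  | 0 => 0
  | s + 1 => max (2 * leftApprox e s) (stageContribution e s)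

theorem leftApprox_lt (e s : ℕ) : leftApprox e s < 2 ^ s := by
  induction s with
  | zero => simp [leftApprox]
  | succ s ih =>
    refine max_lt (by rw [pow_succ]; omega) ?_
    have h1 := Nat.unpair_left_le s
    calc stageContribution e s ≤ (2 ^ s.unpair.1 - 1) * 2 ^ (s + 1 - s.unpair.1) :=
          Nat.mul_le_mul_right _ (min_le_right _ _)
      _ < 2 ^ s.unpair.1 * 2 ^ (s + 1 - s.unpair.1) :=
          Nat.mul_lt_mul_of_pos_right (Nat.sub_lt (by positivity) one_pos) (by positivity)
      _ = 2 ^ (s + 1) := by rw [← pow_add]; congr 1; omega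

theorem two_mul_leftApprox_le (e s : ℕ) : 2 * leftApprox e s ≤ leftApprox e (s + 1) :=
  le_max_left _ _

theorem primrec_stageContribution : Primrec₂ stageContribution := by
  have hs : Primrec fun p : ℕ × ℕ => p.2.unpair := Primrec.unpair.comp Primrec.snd
  have h1 := Primrec.fst.comp hs
  have h2 := Primrec.snd.comp hs
  have hc : Primrec fun p : ℕ × ℕ => Denumerable.ofNat Code p.1 :=
    (Primrec.ofNat Code).comp Primrec.fst
  have he := Code.primrec_evaln.comp ((h2.pair hc).pair h1)
  exact Primrec.nat_mul.comp
    (Primrec.nat_min.comp (Primrec.option_getD.comp he (Primrec.const 0))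
      (Primrec.nat_sub.comp (Primrec.nat_pow.comp (Primrec.const 2) h1) (Primrec.const 1)))
    (Primrec.nat_pow.comp (Primrec.const 2)
      (Primrec.nat_sub.comp (Primrec.succ.comp Primrec.snd) h1))

theorem primrec_leftApprox : Primrec₂ leftApprox :=
  Primrec.nat_rec_of_eq (h := fun e x => max (2 * x.2) (stageContribution e x.1))
    (Primrec.nat_max.comp
      (Primrec.nat_mul.comp (Primrec.const 2) (Primrec.snd.comp Primrec.snd))
      (primrec_stageContribution.comp Primrec.fst (Primrec.fst.comp Primrec.snd)))
    (fun _ => rfl) fun _ _ => rfl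

/-- The `s`-th approximation to the `e`-th left-r.e. set. -/
def leftStage (e s : ℕ) : Set ℕ := dyadicSet (leftApprox e s) s

theorem leftStage_lexLE_succ (e s : ℕ) : LexLE (leftStage e s) (leftStage e (s + 1)) :=
  dyadicSet_lexLE_succ (leftApprox_lt e (s + 1)) (two_mul_leftApprox_le e s)

theorem prefixValue_leftStage (e s m : ℕ) :
    prefixValue (leftStage e s) m = leftApprox e s * 2 ^ m / 2 ^ s :=
  prefixValue_dyadicSet (leftApprox_lt e s) m

theorem computablePred_leftStage :
    ComputablePred fun p : ℕ × ℕ × ℕ => p.2.2 ∈ leftStage p.1 p.2.1 := by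
  have h1 : Primrec fun p : ℕ × ℕ × ℕ => leftApprox p.1 p.2.1 :=
    primrec_leftApprox.comp Primrec.fst (Primrec.fst.comp Primrec.snd)
  have h2 : Primrec fun p : ℕ × ℕ × ℕ =>
      leftApprox p.1 p.2.1 * 2 ^ (p.2.2 + 1) / 2 ^ p.2.1 % 2 :=
    Primrec.nat_mod.comp (Primrec.nat_div.comp (Primrec.nat_mul.comp h1
      (Primrec.nat_pow.comp (Primrec.const 2)
        (Primrec.succ.comp (Primrec.snd.comp Primrec.snd))))
      (Primrec.nat_pow.comp (Primrec.const 2) (Primrec.fst.comp Primrec.snd))) (Primrec.const 2)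
  exact ComputablePred.nat_eq h2.to_comp (Computable.const 1)

/-- A universal left-r.e. numbering. -/
noncomputable def leftSet (e : ℕ) : Set ℕ :=
  (exists_isPointwiseLimit (leftStage_lexLE_succ e)).choose

theorem isPointwiseLimit_leftSet (e : ℕ) : IsPointwiseLimit (leftStage e) (leftSet e) :=
  (exists_isPointwiseLimit (leftStage_lexLE_succ e)).choose_spec

theorem leftStage_lexLE_leftSet (e s : ℕ) : LexLE (leftStage e s) (leftSet e) :=
  (isPointwiseLimit_leftSet e).lexLE (leftStage_lexLE_succ e) s

theorem leftApprox_le_prefixValue (e s : ℕ) : leftApprox e s ≤ prefixValue (leftSet e) s := by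
  have := lexLE_iff.1 (leftStage_lexLE_leftSet e s) s
  rwa [prefixValue_leftStage, Nat.mul_div_cancel _ (by positivity)] at this

/-- Take a code for `s ↦ prefixValue (S s) s`. Every contribution is a prefix of some `S t` padded
with zeros, so the running maximum never exceeds `A`; every such prefix is eventually contributed,
so the limit is not below `A`. -/
theorem IsLeftRE.exists_leftSet_eq {A : Set ℕ} (hA : IsLeftRE A) : ∃ e, leftSet e = A := by
  obtain ⟨S, hS, hmono, hlim⟩ := hA
  have hle := hlim.lexLE hmono
  have hg : Computable fun s => prefixValue (S s) s := prefixValue.computable hS Computable.id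
  obtain ⟨c, hc⟩ := Code.exists_code.1 (Partrec.nat_iff.1 hg.partrec)
  have hev : ∀ {k t g}, g ∈ Code.evaln k c t → g = prefixValue (S t) t := fun {k t g} h => by
    have := Code.evaln_sound h
    rw [hc] at this
    exact Part.mem_some_iff.1 this
  refine ⟨Encodable.encode c, LexLE.antisymm ?_ ?_⟩
  · refine (isPointwiseLimit_leftSet _).lexLE_of_forall fun s => lexLE_iff.2 fun m => ?_
    rw [prefixValue_leftStage]
    refine le_trans (Nat.div_le_div_right (Nat.mul_le_mul_right _ ?_))
      (prefixValue.mul_two_pow_div_le A s m)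
    induction s with
    | zero => simp [leftApprox]
    | succ s ih =>
      refine max_le ?_ ?_
      · have := prefixValue.mul_two_pow_le A s 1
        omega
      · have hs := Nat.unpair_left_le s
        unfold stageContribution
        rw [Denumerable.ofNat_encode]
        generalize s.unpair.1 = t at *
        obtain ⟨d, hd⟩ := Nat.exists_eq_add_of_le (show t ≤ s + 1 by omega)
        rw [hd, Nat.add_sub_cancel_left]
        refine (Nat.mul_le_mul_right _ (min_le_left _ _)).trans
          (le_trans (Nat.mul_le_mul_right _ ?_) (prefixValue.mul_two_pow_le A t d))
        cases h : Code.evaln s.unpair.2 c t with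
        | none => simp
        | some g =>
          rw [Option.getD_some, hev h]
          exact lexLE_iff.1 (hle t) t
  · refine hlim.lexLE_of_forall fun r => lexLE_iff.2 fun m => ?_
    -- `r ≤ t` makes `S t` dominate `S r`, and `m ≤ t` lets the contributed prefix of length `t`
    -- determine the one of length `m`.
    obtain ⟨t, ⟨hrt, hmt⟩⟩ : ∃ t, r ≤ t ∧ m ≤ t := ⟨max r m, le_max_left _ _, le_max_right _ _⟩
    obtain ⟨k, hk⟩ : ∃ k, prefixValue (S t) t ∈ Code.evaln k c t := by
      refine Code.evaln_complete.1 ?_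
      rw [hc]
      exact Part.mem_some _
    set e := Encodable.encode c with he
    have hcon : stageContribution e (Nat.pair t k) =
        prefixValue (S t) t * 2 ^ (Nat.pair t k + 1 - t) := by
      rw [stageContribution, he, Denumerable.ofNat_encode, Nat.unpair_pair, Option.mem_def.1 hk,
        Option.getD_some, min_eq_left]
      exact Nat.le_sub_one_of_lt (prefixValue.lt_two_pow (S t) t)
    have hs : t ≤ Nat.pair t k + 1 := (Nat.left_le_pair t k).trans (Nat.le_succ _)
    have hq : stageContribution e (Nat.pair t k) ≤ leftApprox e (Nat.pair t k + 1) :=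
      le_max_right _ _
    refine le_trans ?_ (lexLE_iff.1 (leftStage_lexLE_leftSet e (Nat.pair t k + 1)) m)
    refine (lexLE_iff.1 (LexLE.of_le hmono hrt) m).trans ?_
    rw [prefixValue_leftStage]
    refine le_trans ?_ (Nat.div_le_div_right (Nat.mul_le_mul_right _ hq))
    rw [hcon]
    generalize Nat.pair t k + 1 = u at *
    obtain ⟨d, rfl⟩ := Nat.exists_eq_add_of_le hs
    obtain ⟨d', rfl⟩ := Nat.exists_eq_add_of_le hmt
    rw [Nat.add_sub_cancel_left, pow_add _ _ d, mul_right_comm, Nat.mul_div_mul_right _ _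
      (by positivity), pow_add, mul_comm (2 ^ m), Nat.mul_div_mul_right _ _ (by positivity),
      prefixValue.div_two_pow]

/-! ### Construction of the minimal set. -/

/-- The upper approximation with denominator `2 ^ m` to the `e`-th left-r.e. real at stage `s`. -/
def ceilApprox (e m s : ℕ) : ℕ := (leftApprox e s * 2 ^ m) ⌈/⌉ 2 ^ s

theorem ceilApprox_le_iff {e m s k : ℕ} :
    ceilApprox e m s ≤ k ↔ leftApprox e s * 2 ^ m ≤ k * 2 ^ s := by
  rw [ceilApprox, ceilDiv_le_iff_le_mul (by positivity), mul_comm k]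

theorem ceilApprox_mono (e m : ℕ) : Monotone (ceilApprox e m) :=
  monotone_nat_of_le_succ fun s => by
    rw [ceilApprox_le_iff]
    have h1 := ceilApprox_le_iff.1 (le_refl (ceilApprox e m (s + 1)))
    have h2 := Nat.mul_le_mul_right (2 ^ m) (two_mul_leftApprox_le e s)
    rw [pow_succ] at h1
    nlinarith

theorem ceilApprox_le (e m s : ℕ) : ceilApprox e m s ≤ 2 ^ m := by
  rw [ceilApprox_le_iff, mul_comm]
  exact Nat.mul_le_mul_left _ (leftApprox_lt e s).le

/-- The sum of the upper approximations of the first `n + 1` left-r.e. reals. -/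
def ceilSum (n m s : ℕ) : ℕ := ∑ e ∈ Finset.range (n + 1), ceilApprox e m s

theorem ceilSum_mono (n m : ℕ) : Monotone (ceilSum n m) :=
  fun _ _ h => Finset.sum_le_sum fun _ _ => ceilApprox_mono _ _ h

theorem ceilSum_le (n m s : ℕ) : ceilSum n m s ≤ (n + 1) * 2 ^ m :=
  (Finset.sum_le_card_nsmul _ _ _ fun e _ => ceilApprox_le e m s).trans (by simp)

theorem ceilApprox_eq_of_ceilSum_eq {e n m s t : ℕ} (hst : s ≤ t) (he : e ≤ n)
    (h : ceilSum n m s = ceilSum n m t) : ceilApprox e m s = ceilApprox e m t :=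
  (Finset.sum_eq_sum_iff_of_le fun e _ => ceilApprox_mono e m hst).1 h e
    (Finset.mem_range.2 (by omega))

/-- The least stage at which `ceilSum n m` takes the value that it has at stage `s`. -/
def settlingStage (n m : ℕ) : ℕ → ℕ
  | 0 => 0
  | s + 1 => if ceilSum n m (s + 1) = ceilSum n m s then settlingStage n m s else s + 1

theorem ceilSum_settlingStage (n m s : ℕ) :
    ceilSum n m (settlingStage n m s) = ceilSum n m s := by
  induction s with
  | zero => rfl
  | succ s ih =>
    rw [settlingStage]
    split_ifs with h
    · rw [ih, h]
    · rfl

theorem ceilSum_eq_of_le_of_le {n m s t u : ℕ} (hst : s ≤ t) (htu : t ≤ u)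
    (h : ceilSum n m u = ceilSum n m s) : ceilSum n m t = ceilSum n m s :=
  ((ceilSum_mono n m htu).trans h.le).antisymm (ceilSum_mono n m hst)

theorem settlingStage_eq {n m s t : ℕ} (hst : s ≤ t) (h : ceilSum n m t = ceilSum n m s) :
    settlingStage n m t = settlingStage n m s := by
  induction t, hst using Nat.le_induction with
  | base => rfl
  | succ t hst ih =>
    have h' := ceilSum_eq_of_le_of_le hst t.le_succ h
    rw [settlingStage, if_pos (h.trans h'.symm), ih h']

theorem lt_settlingStage {n m s t : ℕ} (hst : s ≤ t) (h : ceilSum n m t ≠ ceilSum n m s) :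
    s < settlingStage n m t := by
  induction t, hst using Nat.le_induction with
  | base => exact absurd rfl h
  | succ t hst ih =>
    rw [settlingStage]
    split_ifs with h'
    · exact ih (h' ▸ h)
    · omega

theorem settlingStage_le (n m s : ℕ) : settlingStage n m s ≤ s := by
  induction s with
  | zero => exact le_rfl
  | succ s ih =>
    rw [settlingStage]
    split_ifs <;> omega

/-- The element chosen above the bound `m` at level `n` and stage `s`. -/
def chosenAbove (n m s : ℕ) : ℕ := 2 * (m + ((n + 1) * 2 ^ m - ceilSum n m s))

/-- The bound below which all elements of the first `n` levels at stage `s` lie. -/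
def level (s : ℕ) : ℕ → ℕ
  | 0 => 0
  | n + 1 => chosenAbove n (level s n) s + 1 + settlingStage n (level s n) s

/-- The `n`-th element of the minimal set at stage `s`. -/
def chosen (s n : ℕ) : ℕ := chosenAbove n (level s n) s

theorem level_le_chosen (s n : ℕ) : level s n ≤ chosen s n := by
  rw [chosen, chosenAbove]; omega

theorem chosen_lt_level_succ (s n : ℕ) : chosen s n < level s (n + 1) := by
  rw [chosen, level]; omega

theorem settlingStage_lt_level_succ (s n : ℕ) :
    settlingStage n (level s n) s < level s (n + 1) := by
  rw [level]; omega

theorem level_strictMono (s : ℕ) : StrictMono (level s) :=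
  strictMono_nat_of_lt_succ fun n => (level_le_chosen s n).trans_lt (chosen_lt_level_succ s n)

theorem chosen_strictMono (s : ℕ) : StrictMono (chosen s) :=
  strictMono_nat_of_lt_succ fun n => (chosen_lt_level_succ s n).trans_le (level_le_chosen s _)

/-- The minimal set at stage `s`. -/
def minimalStage (s : ℕ) : Set ℕ := Set.range (chosen s)

theorem even_of_mem_minimalStage {s x : ℕ} (h : x ∈ minimalStage s) : x % 2 = 0 := by
  obtain ⟨n, rfl⟩ := h
  rw [chosen, chosenAbove]; omega

/-- Nothing changes on the first `n` levels between the stages `s` and `t`. -/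
def Unchanged (n s t : ℕ) : Prop :=
  ∀ i < n, ceilSum i (level s i) t = ceilSum i (level s i) s

theorem chosenAbove_eq {n m s t : ℕ} (h : ceilSum n m t = ceilSum n m s) :
    chosenAbove n m t = chosenAbove n m s := by
  rw [chosenAbove, chosenAbove, h]

theorem Unchanged.level_eq {n s t : ℕ} (hst : s ≤ t) (h : Unchanged n s t) :
    level t n = level s n := by
  induction n with
  | zero => rfl
  | succ n ih =>
    have hn := h n n.lt_succ_self
    rw [level, level, ih fun i hi => h i (by omega), chosenAbove_eq hn, settlingStage_eq hst hn]

theorem Unchanged.chosen_eq {n i s t : ℕ} (hst : s ≤ t) (h : Unchanged n s t) (hi : i < n) :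
    chosen t i = chosen s i := by
  rw [chosen, chosen, Unchanged.level_eq hst fun j hj => h j (by omega), chosenAbove_eq (h i hi)]

theorem Unchanged.of_le {n s t u : ℕ} (hst : s ≤ t) (htu : t ≤ u) (h : Unchanged n s u) :
    Unchanged n s t := fun i hi => ceilSum_eq_of_le_of_le hst htu (h i hi)

/-- If something changes, then at the least changing level the element decreases and the later
elements exceed the old stage. -/
theorem exists_least_change {n s t : ℕ} (hst : s ≤ t) (h : ¬ Unchanged n s t) :
    ∃ i < n, Unchanged i s t ∧ chosen t i < chosen s i ∧ s < level t (i + 1) := by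
  classical
  unfold Unchanged at h
  push Not at h
  have hspec := Nat.find_spec h
  have hun : Unchanged (Nat.find h) s t := fun j hj => by
    by_contra hne
    exact Nat.find_min h hj ⟨hj.trans hspec.1, hne⟩
  have hlev := hun.level_eq hst
  refine ⟨Nat.find h, hspec.1, hun, ?_, ?_⟩
  · rw [chosen, chosen, hlev, chosenAbove, chosenAbove]
    have h1 := ceilSum_mono (Nat.find h) (level s (Nat.find h)) hst
    -- Ensures that the subtraction in `chosenAbove` is not truncated, so a larger sum gives a
    -- strictly smaller element.
    have h2 := ceilSum_le (Nat.find h) (level s (Nat.find h)) t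
    have h3 := hspec.2
    omega
  · refine lt_trans ?_ (settlingStage_lt_level_succ t _)
    rw [hlev]
    exact lt_settlingStage hst hspec.2

/-- At the least changing level the element decreases while all earlier ones stay, so the new
element is the least difference. -/
theorem minimalStage_lexLE {s t : ℕ} (hst : s ≤ t) :
    LexLE (minimalStage s) (minimalStage t) := by
  by_cases h : ∀ n, Unchanged n s t
  · refine Or.inl (congrArg Set.range (funext fun n => ?_))
    exact ((h (n + 1)).chosen_eq hst n.lt_succ_self).symm
  · push Not at h
    obtain ⟨n, hn⟩ := h
    obtain ⟨i, -, hun, hlt, -⟩ := exists_least_change hst hn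
    refine Or.inr ⟨chosen t i, ⟨Or.inr ⟨⟨i, rfl⟩, ?_⟩, fun z hz => ?_⟩, ⟨i, rfl⟩⟩
    · rintro ⟨j, hj⟩
      rcases Nat.lt_or_ge j i with hji | hji
      · rw [← hun.chosen_eq hst hji] at hj
        exact absurd ((chosen_strictMono t).injective hj) (by omega)
      · have := (chosen_strictMono s).monotone hji
        omega
    · by_contra hzi
      rcases hz with ⟨⟨j, rfl⟩, hz⟩ | ⟨⟨j, rfl⟩, hz⟩
      · have hji : j < i := (chosen_strictMono s).lt_iff_lt.1 (by omega)
        exact hz ⟨j, hun.chosen_eq hst hji⟩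
      · have hji : j < i := (chosen_strictMono t).lt_iff_lt.1 (by omega)
        exact hz ⟨j, (hun.chosen_eq hst hji).symm⟩

/-- After a change at level `i ≤ n`, the elements before `i` are the old ones, the `i`-th has
dropped below `chosen s n`, and the later ones exceed `s ≥ chosen s n`. None of them equals `chosen
s n`. -/
theorem mem_minimalStage_iff_unchanged {s t n : ℕ} (hst : s ≤ t) (hn : chosen s n ≤ s) :
    chosen s n ∈ minimalStage t ↔ Unchanged (n + 1) s t := by
  constructor
  · intro h
    by_contra hun
    obtain ⟨i, hi, hun, hlt, hlev⟩ := exists_least_change hst hun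
    obtain ⟨j, hj⟩ := h
    rcases Nat.lt_trichotomy j i with hji | rfl | hji
    · rw [hun.chosen_eq hst hji] at hj
      exact absurd ((chosen_strictMono s).injective hj) (by omega)
    · have := (chosen_strictMono s).monotone (show j ≤ n by omega)
      omega
    · have h1 := (level_strictMono t).monotone (show i + 1 ≤ j by omega)
      have h2 := level_le_chosen t j
      omega
  · exact fun h => ⟨n, h.chosen_eq hst n.lt_succ_self⟩

/-- A number that leaves the minimal set late enough never returns. -/
theorem notMem_minimalStage_of_left {x s t u : ℕ} (hxs : x ≤ s) (hst : s ≤ t) (htu : t ≤ u)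
    (hx : x ∈ minimalStage s) (ht : x ∉ minimalStage t) : x ∉ minimalStage u := by
  obtain ⟨n, rfl⟩ := hx
  rw [mem_minimalStage_iff_unchanged hst hxs] at ht
  rw [mem_minimalStage_iff_unchanged (hst.trans htu) hxs]
  exact fun h => ht (h.of_le hst htu)

/-! ### Computability of the construction. -/

theorem primrec_ceilSum : Primrec fun p : ℕ × ℕ × ℕ => ceilSum p.1 p.2.1 p.2.2 := by
  have hc : Primrec fun p : ℕ × ℕ × ℕ => ceilApprox p.1 p.2.1 p.2.2 := by
    have hm : Primrec fun p : ℕ × ℕ × ℕ => p.2.1 := Primrec.fst.comp Primrec.snd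
    have hs : Primrec fun p : ℕ × ℕ × ℕ => p.2.2 := Primrec.snd.comp Primrec.snd
    have h2 := Primrec.nat_pow.comp (Primrec.const 2) hs
    exact (Primrec.nat_div.comp (Primrec.nat_sub.comp (Primrec.nat_add.comp
      (Primrec.nat_mul.comp (primrec_leftApprox.comp Primrec.fst hs)
        (Primrec.nat_pow.comp (Primrec.const 2) hm)) h2) (Primrec.const 1)) h2).of_eq
      fun p => (Nat.ceilDiv_eq_add_pred_div _ _).symm
  have h : Primrec₂ fun (p : ℕ × ℕ) (n : ℕ) => ∑ e ∈ Finset.range n, ceilApprox e p.1 p.2 :=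
    Primrec.nat_rec_of_eq (h := fun p x => x.2 + ceilApprox x.1 p.1 p.2)
      (Primrec.nat_add.comp (Primrec.snd.comp Primrec.snd)
        (hc.comp (Primrec.pair (Primrec.fst.comp Primrec.snd) Primrec.fst)))
      (fun _ => Finset.sum_range_zero _) fun _ _ => Finset.sum_range_succ _ _
  exact h.comp Primrec.snd (Primrec.succ.comp Primrec.fst)

theorem primrec_settlingStage : Primrec fun p : ℕ × ℕ × ℕ => settlingStage p.1 p.2.1 p.2.2 := by
  have hsum : Primrec₂ fun (p : ℕ × ℕ) (s : ℕ) => ceilSum p.1 p.2 s :=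
    primrec_ceilSum.comp (Primrec.pair (Primrec.fst.comp Primrec.fst)
      (Primrec.pair (Primrec.snd.comp Primrec.fst) Primrec.snd))
  have h : Primrec₂ fun (p : ℕ × ℕ) (s : ℕ) => settlingStage p.1 p.2 s :=
    Primrec.nat_rec_of_eq (h := fun p x =>
        if ceilSum p.1 p.2 (x.1 + 1) = ceilSum p.1 p.2 x.1 then x.2 else x.1 + 1)
      (Primrec.ite (Primrec.eq.comp
          (hsum.comp Primrec.fst (Primrec.succ.comp (Primrec.fst.comp Primrec.snd)))
          (hsum.comp Primrec.fst (Primrec.fst.comp Primrec.snd)))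
        (Primrec.snd.comp Primrec.snd) (Primrec.succ.comp (Primrec.fst.comp Primrec.snd)))
      (fun _ => rfl) fun _ _ => rfl
  exact h.comp (Primrec.pair Primrec.fst (Primrec.fst.comp Primrec.snd))
    (Primrec.snd.comp Primrec.snd)

theorem primrec_chosenAbove : Primrec fun p : ℕ × ℕ × ℕ => chosenAbove p.1 p.2.1 p.2.2 := by
  have hm : Primrec fun p : ℕ × ℕ × ℕ => p.2.1 := Primrec.fst.comp Primrec.snd
  exact Primrec.nat_mul.comp (Primrec.const 2) (Primrec.nat_add.comp hm
    (Primrec.nat_sub.comp (Primrec.nat_mul.comp (Primrec.succ.comp Primrec.fst)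
      (Primrec.nat_pow.comp (Primrec.const 2) hm)) primrec_ceilSum))

theorem primrec_level : Primrec₂ level := by
  have hi : Primrec fun q : ℕ × ℕ × ℕ => (q.2.1, q.2.2, q.1) :=
    Primrec.pair (Primrec.fst.comp Primrec.snd) (Primrec.pair (Primrec.snd.comp Primrec.snd)
      Primrec.fst)
  exact Primrec.nat_rec_of_eq (h := fun s x =>
      chosenAbove x.1 x.2 s + 1 + settlingStage x.1 x.2 s)
    (Primrec.nat_add.comp (Primrec.succ.comp (primrec_chosenAbove.comp hi))
      (primrec_settlingStage.comp hi))
    (fun _ => rfl) fun _ _ => rfl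

theorem primrec_chosen : Primrec₂ chosen :=
  primrec_chosenAbove.comp (Primrec.pair Primrec.snd (Primrec.pair primrec_level Primrec.fst))

theorem computablePred_minimalStage :
    ComputablePred fun p : ℕ × ℕ => p.2 ∈ minimalStage p.1 := by
  -- The bound on `n` loses nothing: `chosen` is strictly increasing, so `n ≤ chosen p.1 n`.
  have h : ComputablePred fun p : ℕ × ℕ => ∃ n < p.2 + 1, chosen p.1 n = p.2 :=
    ComputablePred.exists_lt (p := fun (p : ℕ × ℕ) n => chosen p.1 n = p.2)
      (ComputablePred.nat_eq
        (primrec_chosen.to_comp.comp (Computable.fst.comp Computable.fst) Computable.snd)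
        (Computable.snd.comp Computable.fst))
      (Computable.succ.comp Computable.snd)
  refine h.of_eq fun p => ⟨fun ⟨n, _, hn⟩ => ⟨n, hn⟩, fun ⟨n, hn⟩ => ⟨n, ?_, hn⟩⟩
  have := (chosen_strictMono p.1).id_le n
  simp only [id_eq] at this
  omega

/-! ### The limit set and its minimality. -/

/-- The limit of the sets `minimalStage s`. -/
noncomputable def minimalSet : Set ℕ :=
  (exists_isPointwiseLimit fun s => minimalStage_lexLE s.le_succ).choose

theorem isPointwiseLimit_minimalSet : IsPointwiseLimit minimalStage minimalSet :=
  (exists_isPointwiseLimit fun s => minimalStage_lexLE s.le_succ).choose_spec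

theorem isLeftRE_minimalSet : IsLeftRE minimalSet :=
  ⟨minimalStage, computablePred_minimalStage, fun s => minimalStage_lexLE s.le_succ,
    isPointwiseLimit_minimalSet⟩

theorem eventually_ceilSum (n m : ℕ) : ∃ N, ∀ s ≥ N, ceilSum n m s = ceilSum n m N :=
  exists_eventually_eq_of_monotone (ceilSum_mono n m) (ceilSum_le n m)

/-- Once the first `n` levels are fixed, so is the bound `level N n`, and the sum at this fixed
bound is monotone and bounded. -/
theorem exists_unchanged (n : ℕ) : ∃ N, ∀ s ≥ N, Unchanged n N s := by
  induction n with
  | zero => exact ⟨0, fun _ _ i hi => absurd hi (by omega)⟩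
  | succ n ih =>
    obtain ⟨N, hN⟩ := ih
    obtain ⟨N', hN'⟩ := eventually_ceilSum n (level N n)
    refine ⟨max N N', fun s hs i hi => ?_⟩
    have hM : N ≤ max N N' := le_max_left _ _
    have hlev : level (max N N') i = level N i :=
      Unchanged.level_eq hM fun j hj => hN _ hM j (by omega)
    rw [hlev]
    rcases Nat.lt_succ_iff_lt_or_eq.1 hi with h | rfl
    · rw [hN _ (hM.trans hs) i h, hN _ hM i h]
    · rw [hN' _ ((le_max_right _ _).trans hs), hN' _ (le_max_right _ _)]

/-- Rounding up is essential: with no element in `[m, T)`, the approximation at stage `T` is at most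
the truncation of the real at `m`. An element beyond `m` later carries the approximation strictly
above that truncation, which rounding up detects and rounding down might not. -/
theorem exists_mem_leftSet_lt_settlingStage {e n m N : ℕ} (he : e ≤ n)
    (hN : ∀ s ≥ N, ceilSum n m s = ceilSum n m N) (hinf : (leftSet e).Infinite) :
    ∃ y ∈ leftSet e, m ≤ y ∧ y < settlingStage n m N := by
  set T := settlingStage n m N with hT
  by_contra hno
  push Not at hno
  have hno' : ∀ x, m ≤ x → x < T → x ∉ leftSet e := fun x h1 h2 h3 =>
    absurd h2 (not_lt.2 (hno x h3 h1))
  obtain ⟨y, hy, hmy⟩ := hinf.exists_gt m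
  have hTc : ceilApprox e m T ≤ prefixValue (leftSet e) m :=
    ceilApprox_le_iff.2 ((Nat.mul_le_mul_right _ (leftApprox_le_prefixValue e T)).trans
      (prefixValue.mul_le_of_forall_notMem hno'))
  obtain ⟨s, hs, hNs⟩ := (((isPointwiseLimit_leftSet e).eventually_prefixValue (y + 1)).and
    (Filter.eventually_ge_atTop N)).exists
  have heq : ceilApprox e m T = ceilApprox e m s :=
    ceilApprox_eq_of_ceilSum_eq ((settlingStage_le n m N).trans hNs) he
      ((ceilSum_settlingStage n m N).trans (hN s hNs).symm)
  rw [heq, ceilApprox_le_iff] at hTc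
  rw [prefixValue_leftStage] at hs
  have h1 : prefixValue (leftSet e) (y + 1) * 2 ^ s ≤ leftApprox e s * 2 ^ (y + 1) := by
    rw [← hs]
    exact Nat.div_mul_le_self _ _
  have h2 := prefixValue.lt_of_mem hmy.le hy
  have h3 : 0 < 2 ^ s := by positivity
  have := calc prefixValue (leftSet e) m * 2 ^ (y + 1) * 2 ^ s
      < prefixValue (leftSet e) (y + 1) * 2 ^ m * 2 ^ s := Nat.mul_lt_mul_of_pos_right h2 h3
    _ = prefixValue (leftSet e) (y + 1) * 2 ^ s * 2 ^ m := by ring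
    _ ≤ leftApprox e s * 2 ^ (y + 1) * 2 ^ m := Nat.mul_le_mul_right _ h1
    _ = leftApprox e s * 2 ^ m * 2 ^ (y + 1) := by ring
    _ ≤ prefixValue (leftSet e) m * 2 ^ s * 2 ^ (y + 1) := Nat.mul_le_mul_right _ hTc
    _ = prefixValue (leftSet e) m * 2 ^ (y + 1) * 2 ^ s := by ring
  exact lt_irrefl _ this

theorem exists_mem_minimalStage {x : ℕ} (hx : x ∈ minimalSet) (N : ℕ) :
    ∃ s ≥ N, x ∈ minimalStage s := by
  obtain ⟨s, hs, hNs⟩ := ((isPointwiseLimit_minimalSet x).and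
    (Filter.eventually_ge_atTop N)).exists
  exact ⟨s, hNs, hs.2 hx⟩

theorem chosen_mem_minimalSet {n N : ℕ} (hN : ∀ s ≥ N, Unchanged (n + 1) N s) :
    chosen N n ∈ minimalSet := by
  obtain ⟨s, hs, hNs⟩ := ((isPointwiseLimit_minimalSet (chosen N n)).and
    (Filter.eventually_ge_atTop N)).exists
  exact hs.1 ⟨n, (hN s hNs).chosen_eq hNs n.lt_succ_self⟩

theorem infinite_minimalSet : minimalSet.Infinite := by
  refine Set.infinite_of_not_bddAbove fun ⟨b, hb⟩ => ?_
  obtain ⟨N, hN⟩ := exists_unchanged (b + 2)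
  have h1 := hb (chosen_mem_minimalSet hN)
  have h2 := (chosen_strictMono N).id_le (b + 1)
  simp only [id_eq] at h2
  omega

/-- `leftSet e` has an element between `level N n` and the settling stage, which lies below `level N
(n + 1)`. It belongs to the minimal set, whose only element in that range is the `n`-th. -/
theorem chosen_mem_leftSet {e b n N : ℕ} (hinf : (leftSet e).Infinite)
    (hb : ∀ x ∈ leftSet e, b ≤ x → x ∈ minimalSet) (he : e ≤ n) (hbn : b ≤ n)
    (hN : ∀ s ≥ N, Unchanged (n + 1) N s) : chosen N n ∈ leftSet e := by
  obtain ⟨y, hy, hmy, hyT⟩ := exists_mem_leftSet_lt_settlingStage (m := level N n) he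
    (fun s hs => hN s hs n n.lt_succ_self) hinf
  have hbm : b ≤ level N n := hbn.trans ((level_strictMono N).id_le n)
  obtain ⟨s, hNs, j, rfl⟩ := exists_mem_minimalStage (hb y hy (hbm.trans hmy)) N
  have hun := hN s hNs
  rcases Nat.lt_trichotomy j n with hj | rfl | hj
  · have h1 := chosen_lt_level_succ s j
    have h2 := (level_strictMono s).monotone (show j + 1 ≤ n by omega)
    rw [Unchanged.level_eq (n := n) hNs fun i hi => hun i (by omega)] at h2
    omega
  · rwa [hun.chosen_eq hNs j.lt_succ_self] at hy
  · have h1 := level_le_chosen s j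
    have h2 := (level_strictMono s).monotone (show n + 1 ≤ j by omega)
    rw [hun.level_eq hNs] at h2
    have h3 := settlingStage_lt_level_succ N n
    omega

/-- Only elements of levels below `max e (b + 1)` can be missing from `E`, and these lie below a
bound that has settled by stage `N'`. -/
theorem finite_minimalSet_diff {E : Set ℕ} (hE : IsLeftRE E) (hinf : E.Infinite)
    (hsub : (E \ minimalSet).Finite) : (minimalSet \ E).Finite := by
  obtain ⟨e, rfl⟩ := hE.exists_leftSet_eq
  obtain ⟨b, hb⟩ := hsub.bddAbove
  have hb' : ∀ x ∈ leftSet e, b + 1 ≤ x → x ∈ minimalSet := fun x hx hbx => by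
    by_contra h
    have := hb ⟨hx, h⟩
    omega
  obtain ⟨N', hN'⟩ := exists_unchanged (max e (b + 1))
  refine (Set.finite_Iio (level N' (max e (b + 1)))).subset fun x hx => ?_
  obtain ⟨N, hN⟩ := exists_unchanged (x + 1)
  obtain ⟨s, hs, j, hj⟩ := exists_mem_minimalStage hx.1 (max N N')
  have hNs : N ≤ s := (le_max_left _ _).trans hs
  have hjx : j ≤ x := hj ▸ (chosen_strictMono s).id_le j
  have hjN : chosen N j = x := by
    rw [← hj]
    exact ((hN s hNs).chosen_eq hNs (by omega)).symm
  have hjM : j < max e (b + 1) := by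
    by_contra h
    refine hx.2 (hjN ▸ chosen_mem_leftSet hinf hb' (by omega) (by omega) fun t ht i hi =>
      hN t ht i (by omega))
  have h1 := chosen_lt_level_succ s j
  have h2 := (level_strictMono s).monotone (show j + 1 ≤ max e (b + 1) from hjM)
  have hNs' : N' ≤ s := (le_max_right _ _).trans hs
  rw [(hN' s hNs').level_eq hNs'] at h2
  exact Set.mem_Iio.2 (by omega)

theorem isMinimalLeftRE_minimalSet : IsMinimalLeftRE minimalSet := by
  refine ⟨isLeftRE_minimalSet, ⟨by simp, by simpa using infinite_minimalSet⟩, ?_⟩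
  rintro ⟨E, hE, ⟨-, hinf⟩, hsub, hdiff⟩
  exact hdiff (finite_minimalSet_diff hE (by simpa using hinf) hsub)

/-! ### A numbering whose index set of the minimal set is the minimal set. -/

/-- The stages of the set with index `2 * x`: empty until `x` enters the minimal set, then
following the minimal set, and full once `x` has left it. -/
def evenStage (x s : ℕ) : Set ℕ :=
  {n | (∃ t < s + 1, x ≤ t ∧ x ∈ minimalStage t) ∧ (x ∈ minimalStage s → n ∈ minimalStage s)}

/-- From stage `t` on, follow the left-r.e. set with index `d` as long as its first `x` values and
those of the minimal set do not change and differ from each other, and be full afterwards. -/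
def oddStage (d x t s : ℕ) : Set ℕ :=
  {n | t ≤ s ∧ ((prefixValue (leftStage d s) x = prefixValue (leftStage d t) x ∧
    prefixValue (minimalStage s) x = prefixValue (minimalStage t) x ∧
    prefixValue (leftStage d t) x ≠ prefixValue (minimalStage t) x) → n ∈ leftStage d s)}

/-- The stages of the numbering that makes the minimal set into itself. -/
def selfStage (e s : ℕ) : Set ℕ :=
  {n | (e % 2 = 0 ∧ n ∈ evenStage e s) ∨ (¬ e % 2 = 0 ∧
    n ∈ oddStage (e / 2).unpair.1 (e / 2).unpair.2.unpair.1 (e / 2).unpair.2.unpair.2 s)}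

theorem selfStage_of_even {e : ℕ} (he : e % 2 = 0) (s : ℕ) : selfStage e s = evenStage e s :=
  Set.ext fun n => by simp [selfStage, he]

theorem selfStage_of_odd {e : ℕ} (he : e % 2 = 1) (s : ℕ) :
    selfStage e s = oddStage (e / 2).unpair.1 (e / 2).unpair.2.unpair.1
      (e / 2).unpair.2.unpair.2 s :=
  Set.ext fun n => by simp [selfStage, he]

theorem oddStage_of_lt {d x t s : ℕ} (h : s < t) : oddStage d x t s = ∅ :=
  Set.eq_empty_of_forall_notMem fun _ hn => absurd hn.1 (by omega)

/-- The condition under which `oddStage` still follows its left-r.e. set. -/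
def Follows (d x t s : ℕ) : Prop :=
  prefixValue (leftStage d s) x = prefixValue (leftStage d t) x ∧
    prefixValue (minimalStage s) x = prefixValue (minimalStage t) x ∧
    prefixValue (leftStage d t) x ≠ prefixValue (minimalStage t) x

theorem oddStage_of_follows {d x t s : ℕ} (hts : t ≤ s) (h : Follows d x t s) :
    oddStage d x t s = leftStage d s :=
  Set.ext fun _ => ⟨fun hn => hn.2 h, fun hn => ⟨hts, fun _ => hn⟩⟩

theorem oddStage_of_not_follows {d x t s : ℕ} (hts : t ≤ s) (h : ¬ Follows d x t s) :
    oddStage d x t s = Set.univ :=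
  Set.eq_univ_of_forall fun _ => ⟨hts, fun h' => absurd h' h⟩

theorem Follows.of_le {d x t s u : ℕ} (hts : t ≤ s) (hsu : s ≤ u) (h : Follows d x t u) :
    Follows d x t s := by
  have hd := fun {a b} (hab : a ≤ b) =>
    lexLE_iff.1 (LexLE.of_le (leftStage_lexLE_succ d) hab) x
  have hm := fun {a b} (hab : a ≤ b) => lexLE_iff.1 (minimalStage_lexLE hab) x
  exact ⟨((hd hsu).trans h.1.le).antisymm (hd hts), ((hm hsu).trans h.2.1.le).antisymm (hm hts),
    h.2.2⟩

/-- By `Follows.of_le` a failed guess stays failed, so the stages pass from empty to a copy to `ℕ`,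
never back. -/
theorem oddStage_lexLE_succ (d x t s : ℕ) :
    LexLE (oddStage d x t s) (oddStage d x t (s + 1)) := by
  rcases Nat.lt_or_ge s t with h | h
  · rw [oddStage_of_lt h]
    exact LexLE.of_subset (Set.empty_subset _)
  · by_cases hf : Follows d x t (s + 1)
    · rw [oddStage_of_follows (by omega) hf, oddStage_of_follows h (hf.of_le h s.le_succ)]
      exact leftStage_lexLE_succ d s
    · rw [oddStage_of_not_follows (by omega) hf]
      exact LexLE.of_subset (Set.subset_univ _)

/-- `x` has been in the minimal set at some stage between `x` and `s`. -/
def Entered (x s : ℕ) : Prop := ∃ t < s + 1, x ≤ t ∧ x ∈ minimalStage t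

theorem evenStage_of_not_entered {x s : ℕ} (h : ¬ Entered x s) : evenStage x s = ∅ :=
  Set.eq_empty_of_forall_notMem fun _ hn => h hn.1

theorem evenStage_of_mem {x s : ℕ} (h : Entered x s) (hx : x ∈ minimalStage s) :
    evenStage x s = minimalStage s :=
  Set.ext fun _ => ⟨fun hn => hn.2 hx, fun hn => ⟨h, fun _ => hn⟩⟩

theorem evenStage_of_notMem {x s : ℕ} (h : Entered x s) (hx : x ∉ minimalStage s) :
    evenStage x s = Set.univ :=
  Set.eq_univ_of_forall fun _ => ⟨h, fun h' => absurd h' hx⟩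

theorem Entered.mono {x s t : ℕ} (h : Entered x s) (hst : s ≤ t) : Entered x t := by
  obtain ⟨r, hr, h'⟩ := h
  exact ⟨r, by omega, h'⟩

/-- The clause `x ≤ t` in `Entered` is there for this: only numbers not exceeding the stage are
known never to return. -/
theorem Entered.notMem_of_notMem {x s t : ℕ} (h : Entered x s) (hx : x ∉ minimalStage s)
    (hst : s ≤ t) : x ∉ minimalStage t := by
  obtain ⟨r, hr, hxr, hxm⟩ := h
  exact notMem_minimalStage_of_left hxr (by omega) hst hxm hx

theorem evenStage_lexLE_succ (x s : ℕ) : LexLE (evenStage x s) (evenStage x (s + 1)) := by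
  by_cases h : Entered x s
  · by_cases hx : x ∈ minimalStage (s + 1)
    · rw [evenStage_of_mem (h.mono s.le_succ) hx, evenStage_of_mem h
        (by_contra fun h' => h.notMem_of_notMem h' s.le_succ hx)]
      exact minimalStage_lexLE s.le_succ
    · rw [evenStage_of_notMem (h.mono s.le_succ) hx]
      exact LexLE.of_subset (Set.subset_univ _)
  · rw [evenStage_of_not_entered h]
    exact LexLE.of_subset (Set.empty_subset _)

theorem selfStage_lexLE_succ (e s : ℕ) : LexLE (selfStage e s) (selfStage e (s + 1)) := by
  rcases Nat.mod_two_eq_zero_or_one e with h | h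
  · rw [selfStage_of_even h, selfStage_of_even h]
    exact evenStage_lexLE_succ e s
  · rw [selfStage_of_odd h, selfStage_of_odd h]
    exact oddStage_lexLE_succ _ _ _ s

/-- The left-r.e. numbering that makes the minimal set into itself. -/
noncomputable def selfSet (e : ℕ) : Set ℕ :=
  (exists_isPointwiseLimit (selfStage_lexLE_succ e)).choose

theorem isPointwiseLimit_selfSet (e : ℕ) : IsPointwiseLimit (selfStage e) (selfSet e) :=
  (exists_isPointwiseLimit (selfStage_lexLE_succ e)).choose_spec

theorem minimalSet_ne_empty : minimalSet ≠ ∅ := infinite_minimalSet.nonempty.ne_empty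

theorem even_of_mem_minimalSet {x : ℕ} (h : x ∈ minimalSet) : x % 2 = 0 := by
  obtain ⟨s, -, hs⟩ := exists_mem_minimalStage h 0
  exact even_of_mem_minimalStage hs

theorem minimalSet_ne_univ : minimalSet ≠ Set.univ := fun h => by
  have := even_of_mem_minimalSet (h ▸ Set.mem_univ 1)
  omega

theorem selfSet_eq_of_mem {e : ℕ} (h : e ∈ minimalSet) : selfSet e = minimalSet := by
  refine (isPointwiseLimit_selfSet e).unique (isPointwiseLimit_minimalSet.congr' ?_)
  filter_upwards [isPointwiseLimit_minimalSet e, Filter.eventually_ge_atTop e] with s hs hes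
  rw [selfStage_of_even (even_of_mem_minimalSet h)]
  exact evenStage_of_mem ⟨s, by omega, hes, hs.2 h⟩ (hs.2 h)

theorem selfSet_ne_of_even {e : ℕ} (he : e % 2 = 0) (h : e ∉ minimalSet) :
    selfSet e ≠ minimalSet := by
  by_cases hent : ∃ s, Entered e s
  · obtain ⟨s, hs⟩ := hent
    refine ne_of_eq_of_ne ((isPointwiseLimit_selfSet e).unique
      ((IsPointwiseLimit.const Set.univ).congr' ?_)) minimalSet_ne_univ.symm
    filter_upwards [isPointwiseLimit_minimalSet e, Filter.eventually_ge_atTop s] with t ht hst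
    rw [selfStage_of_even he]
    exact evenStage_of_notMem (hs.mono hst) (mt ht.1 h)
  · push Not at hent
    refine ne_of_eq_of_ne ((isPointwiseLimit_selfSet e).unique
      ((IsPointwiseLimit.const ∅).congr' ?_)) minimalSet_ne_empty.symm
    refine Filter.Eventually.of_forall fun t => ?_
    rw [selfStage_of_even he]
    exact evenStage_of_not_entered (hent t)

/-- If the guess holds forever, the two frozen prefixes of length `x` differ and so do the limits.
If it fails, the limit is `ℕ`, whereas the minimal set has only even elements. -/
theorem selfSet_ne_of_odd {e : ℕ} (he : e % 2 = 1) : selfSet e ≠ minimalSet := by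
  set d := (e / 2).unpair.1 with hd
  set x := (e / 2).unpair.2.unpair.1 with hx
  set t := (e / 2).unpair.2.unpair.2 with ht
  have hst : selfStage e = oddStage d x t := funext fun s => selfStage_of_odd he s
  have hlim := isPointwiseLimit_selfSet e
  rw [hst] at hlim
  by_cases hf : ∀ s ≥ t, Follows d x t s
  · intro heq
    obtain ⟨s, ⟨h1, h2⟩, hts⟩ := (((hlim.eventually_prefixValue x).and
      (isPointwiseLimit_minimalSet.eventually_prefixValue x)).and
      (Filter.eventually_ge_atTop t)).exists
    have h := hf s hts
    rw [oddStage_of_follows hts h, heq, ← h2] at h1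
    exact h.2.2 (h.1.symm.trans (h1.trans h.2.1))
  · push Not at hf
    obtain ⟨s, hts, hs⟩ := hf
    refine ne_of_eq_of_ne (hlim.unique
      ((IsPointwiseLimit.const Set.univ).congr' ?_)) minimalSet_ne_univ.symm
    filter_upwards [Filter.eventually_ge_atTop s] with u hu
    exact oddStage_of_not_follows (hts.trans hu) fun h => hs (h.of_le hts hu)

/-- The minimal set is indexed by any of its own elements. Any other left-r.e. set has a correct
guess: a length `x` where the prefixes differ and a stage `t` by which both have settled. -/
theorem exists_selfSet_eq {A : Set ℕ} (hA : IsLeftRE A) : ∃ e, selfSet e = A := by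
  by_cases hAm : A = minimalSet
  · obtain ⟨e, he⟩ := infinite_minimalSet.nonempty
    exact ⟨e, hAm ▸ selfSet_eq_of_mem he⟩
  obtain ⟨d, rfl⟩ := hA.exists_leftSet_eq
  obtain ⟨x, hx⟩ : ∃ x, prefixValue (leftSet d) x ≠ prefixValue minimalSet x := by
    by_contra h
    push Not at h
    exact hAm (prefixValue.ext h)
  obtain ⟨t, ht⟩ := Filter.eventually_atTop.1
    (((isPointwiseLimit_leftSet d).eventually_prefixValue x).and
      (isPointwiseLimit_minimalSet.eventually_prefixValue x))
  have htt := ht t le_rfl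
  refine ⟨2 * Nat.pair d (Nat.pair x t) + 1, (isPointwiseLimit_selfSet _).unique
    ((isPointwiseLimit_leftSet d).congr' ?_)⟩
  filter_upwards [Filter.eventually_ge_atTop t] with s hs
  rw [selfStage_of_odd (by omega), show (2 * Nat.pair d (Nat.pair x t) + 1) / 2 =
    Nat.pair d (Nat.pair x t) by omega, Nat.unpair_pair, Nat.unpair_pair]
  have hts := ht s hs
  exact oddStage_of_follows hs ⟨hts.1.trans htt.1.symm, hts.2.trans htt.2.symm, by
    rwa [htt.1, htt.2]⟩

theorem computablePred_evenStage :
    ComputablePred fun p : ℕ × ℕ × ℕ => p.2.2 ∈ evenStage p.1 p.2.1 := by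
  have hx : Computable fun p : ℕ × ℕ × ℕ => p.1 := Computable.fst
  have hs : Computable fun p : ℕ × ℕ × ℕ => p.2.1 := Computable.fst.comp Computable.snd
  have hn : Computable fun p : ℕ × ℕ × ℕ => p.2.2 := Computable.snd.comp Computable.snd
  have h1 : ComputablePred fun p : ℕ × ℕ × ℕ => ∃ t < p.2.1 + 1, p.1 ≤ t ∧ p.1 ∈ minimalStage t :=
    ComputablePred.exists_lt (p := fun (p : ℕ × ℕ × ℕ) t => p.1 ≤ t ∧ p.1 ∈ minimalStage t)
      ((ComputablePred.nat_le (hx.comp Computable.fst) Computable.snd).and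
        (computablePred_minimalStage.comp (Computable.pair Computable.snd
          (hx.comp Computable.fst))))
      (Computable.succ.comp hs)
  exact (h1.and ((computablePred_minimalStage.comp (Computable.pair hs hx)).not.or
    (computablePred_minimalStage.comp (Computable.pair hs hn)))).of_eq
    fun p => and_congr_right fun _ => imp_iff_not_or.symm

theorem computablePred_oddStage {α : Type*} [Primcodable α] {d x t s n : α → ℕ}
    (hd : Computable d) (hx : Computable x) (ht : Computable t) (hs : Computable s)
    (hn : Computable n) : ComputablePred fun a => n a ∈ oddStage (d a) (x a) (t a) (s a) := by
  have hl : ∀ {f : α → ℕ}, Computable f →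
      Computable fun a => prefixValue (leftStage (d a) (f a)) (x a) := fun {f} hf =>
    prefixValue.computable (S := fun a => leftStage (d a) (f a))
      (computablePred_leftStage.comp ((hd.comp Computable.fst).pair
        ((hf.comp Computable.fst).pair Computable.snd))) hx
  have hm : ∀ {f : α → ℕ}, Computable f →
      Computable fun a => prefixValue (minimalStage (f a)) (x a) := fun {f} hf =>
    prefixValue.computable (S := fun a => minimalStage (f a))
      (computablePred_minimalStage.comp ((hf.comp Computable.fst).pair Computable.snd)) hx
  have h1 := (ComputablePred.nat_eq (hl hs) (hl ht)).and
    ((ComputablePred.nat_eq (hm hs) (hm ht)).and (ComputablePred.nat_eq (hl ht) (hm ht)).not)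
  have h2 := computablePred_leftStage.comp (hd.pair (hs.pair hn))
  exact ((ComputablePred.nat_le ht hs).and (h1.not.or h2)).of_eq
    fun a => and_congr_right fun _ => imp_iff_not_or.symm

theorem computablePred_selfStage :
    ComputablePred fun p : ℕ × ℕ × ℕ => p.2.2 ∈ selfStage p.1 p.2.1 := by
  have hp : Computable fun p : ℕ × ℕ × ℕ => (p.1 / 2).unpair :=
    Computable.unpair.comp
      (Primrec.nat_div.to_comp.comp Computable.fst (Computable.const 2))
  have hp2 := Computable.unpair.comp (Computable.snd.comp hp)
  exact ComputablePred.ite_prop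
    (ComputablePred.nat_eq (Primrec.nat_mod.to_comp.comp Computable.fst (Computable.const 2))
      (Computable.const 0))
    computablePred_evenStage
    (computablePred_oddStage (Computable.fst.comp hp) (Computable.fst.comp hp2)
      (Computable.snd.comp hp2) (Computable.fst.comp Computable.snd)
      (Computable.snd.comp Computable.snd))

theorem canBeMadeIntoItself_minimalSet : CanBeMadeIntoItself {minimalSet} := by
  refine ⟨selfSet, ⟨⟨selfStage, computablePred_selfStage, selfStage_lexLE_succ,
    isPointwiseLimit_selfSet⟩, fun A hA => exists_selfSet_eq hA⟩, ?_⟩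
  refine Set.mem_singleton_iff.2 (Set.ext fun e => ⟨fun h => ?_, fun h => selfSet_eq_of_mem h⟩)
  by_contra he
  rcases Nat.mod_two_eq_zero_or_one e with h2 | h2
  · exact selfSet_ne_of_even h2 he h
  · exact selfSet_ne_of_odd h2 h

/-! ### Maximal left-r.e. sets. -/

theorem LexLE.inter_Iio {A B : Set ℕ} (h : LexLE A B) {i j : ℕ} (hij : i ≤ j) :
    LexLE (A ∩ Set.Iio i) (B ∩ Set.Iio j) := by
  refine LexLE.trans (B := B ∩ Set.Iio i) ?_
    (LexLE.of_subset (Set.inter_subset_inter_right _ (Set.Iio_subset_Iio hij)))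
  have hsymm : symmDiff (A ∩ Set.Iio i) (B ∩ Set.Iio i) = symmDiff A B ∩ Set.Iio i := by
    ext z
    simp only [Set.mem_symmDiff, Set.mem_inter_iff]
    tauto
  rcases h with rfl | ⟨x, hx, hxB⟩
  · exact LexLE.refl _
  · rcases Nat.lt_or_ge x i with hxi | hxi
    · exact Or.inr ⟨x, hsymm ▸ ⟨⟨hx.1, hxi⟩, fun z hz => hx.2 hz.1⟩, hxB, hxi⟩
    · refine Or.inl (symmDiff_eq_bot.1 (hsymm.trans (Set.eq_empty_of_forall_notMem ?_)))
      rintro z ⟨hz, hzi⟩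
      have := hx.2 hz
      exact absurd hzi (not_lt.2 (hxi.trans this))

theorem LexLE.union_right {A B R : Set ℕ} (h : LexLE A B) (hR : Disjoint B R) :
    LexLE (A ∪ R) (B ∪ R) := by
  rcases h with rfl | ⟨x, hx, hxB⟩
  · exact LexLE.refl _
  · have hxA : x ∉ A := fun hA => by simpa [Set.mem_symmDiff, hA, hxB] using hx.1
    have hxR : x ∉ R := Set.disjoint_left.1 hR hxB
    refine Or.inr ⟨x, ⟨Or.inr ⟨Or.inl hxB, fun h => h.elim hxA hxR⟩, fun z hz => hx.2 ?_⟩,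
      Or.inl hxB⟩
    simp only [Set.mem_symmDiff, Set.mem_union] at hz ⊢
    tauto

/-- Approximations to `B` may meet `R` temporarily, and adding `Q` could then destroy monotonicity.
So at step `i` one waits for a stage whose part below `i` misses `R`; the least difference of
successive sets then lies outside `Q`. -/
theorem IsLeftRE.union_of_disjoint {B R Q : Set ℕ} (hB : IsLeftRE B)
    (hR : ComputablePred fun n => n ∈ R) (hQ : ComputablePred fun n => n ∈ Q) (hQR : Q ⊆ R)
    (hBR : Disjoint B R) : IsLeftRE (B ∪ Q) := by
  obtain ⟨S, hS, hmono, hlim⟩ := hB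
  have hex : ∃ t : ℕ → ℕ, Computable t ∧ (∀ i, i ≤ t i ∧ ¬ ∃ x < i, x ∈ S (t i) ∧ x ∈ R) ∧
      ∀ i n, (i ≤ n ∧ ¬ ∃ x < i, x ∈ S n ∧ x ∈ R) → t i ≤ n := by
    refine ComputablePred.exists_find (p := fun i t => i ≤ t ∧ ¬ ∃ x < i, x ∈ S t ∧ x ∈ R)
      ((ComputablePred.nat_le Computable.fst Computable.snd).and
        (ComputablePred.exists_lt (p := fun (a : ℕ × ℕ) x => x ∈ S a.2 ∧ x ∈ R)
          ((hS.comp ((Computable.snd.comp Computable.fst).pair Computable.snd)).and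
            (hR.comp Computable.snd)) Computable.fst).not) fun i => ?_
    obtain ⟨t, ht, hit⟩ := ((hlim.eventually_prefixValue i).and
      (Filter.eventually_ge_atTop i)).exists
    exact ⟨t, hit, fun ⟨x, hx, hxS, hxR⟩ =>
      Set.disjoint_left.1 hBR ((prefixValue.eq_iff.1 ht x hx).1 hxS) hxR⟩
  obtain ⟨t, htc, ht, htmin⟩ := hex
  -- Minimality of `t i` is used here: a stage suitable for `i + 1` is suitable for `i`.
  have htmono : ∀ i, t i ≤ t (i + 1) := fun i => htmin i _
    ⟨i.le_succ.trans (ht (i + 1)).1, fun ⟨x, hx, h⟩ => (ht (i + 1)).2 ⟨x, by omega, h⟩⟩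
  refine ⟨fun i => S (t i) ∩ Set.Iio i ∪ Q, ?_, fun i => ?_, fun n => ?_⟩
  · exact ((hS.comp ((htc.comp Computable.fst).pair Computable.snd)).and
      (ComputablePred.nat_lt Computable.snd Computable.fst)).or (hQ.comp Computable.snd)
  · refine LexLE.union_right ((LexLE.of_le hmono (htmono i)).inter_Iio i.le_succ)
      (Set.disjoint_left.2 fun x hx hxQ => (ht (i + 1)).2 ⟨x, hx.2, hx.1, hQR hxQ⟩)
  · obtain ⟨N, hN⟩ := Filter.eventually_atTop.1 (hlim n)
    filter_upwards [Filter.eventually_ge_atTop N, Filter.eventually_gt_atTop n] with i hi hni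
    simp only [Set.mem_union, Set.mem_inter_iff, Set.mem_Iio, hni, and_true,
      hN (t i) (hi.trans (ht i).1)]

/-- An infinite recursive set splits into two infinite recursive sets. -/
theorem exists_computable_split {R : Set ℕ} (hR : ComputablePred fun n => n ∈ R)
    (hinf : R.Infinite) : ∃ Q ⊆ R, (ComputablePred fun n => n ∈ Q) ∧ Q.Infinite ∧
      (R \ Q).Infinite := by
  classical
  have hc : Computable fun n => Nat.count (· ∈ R) n := by
    have h : Computable fun n => Nat.rec (motive := fun _ => ℕ) 0
        (fun i c => c + if i ∈ R then 1 else 0) n :=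
      Computable.nat_rec (h := fun _ (x : ℕ × ℕ) => x.2 + if x.1 ∈ R then 1 else 0)
        Computable.id (Computable.const 0)
        (Primrec.nat_add.to_comp.comp (Computable.snd.comp Computable.snd)
          ((ComputablePred.ite_value (hR.comp (Computable.fst.comp Computable.snd))
            (Computable.const 1) (Computable.const 0)).of_eq fun a => by congr))
    refine h.of_eq fun n => ?_
    induction n with
    | zero => rfl
    | succ n ih => simp only [ih, Nat.count_succ]
  have hinf' : (Set.ofPred (· ∈ R)).Infinite := hinf
  have hnth : ∀ k, Nat.nth (· ∈ R) k ∈ R := Nat.nth_mem_of_infinite hinf'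
  have hcount := Nat.count_nth_of_infinite (p := (· ∈ R)) hinf'
  have hinj := Nat.nth_injective hinf'
  -- The elements of `R` are split by the parity of their rank in `R`.
  refine ⟨{n | n ∈ R ∧ Nat.count (· ∈ R) n % 2 = 1}, fun n h => h.1, ?_, ?_, ?_⟩
  · exact hR.and (ComputablePred.nat_eq
      (Primrec.nat_mod.to_comp.comp hc (Computable.const 2)) (Computable.const 1))
  · refine Set.infinite_of_injective_forall_mem (f := fun k => Nat.nth (· ∈ R) (2 * k + 1))
      (fun a b h => by have := hinj h; omega) fun k => ⟨hnth _, ?_⟩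
    rw [hcount]
    omega
  · refine Set.infinite_of_injective_forall_mem (f := fun k => Nat.nth (· ∈ R) (2 * k))
      (fun a b h => by have := hinj h; omega) fun k => ⟨hnth _, fun h => ?_⟩
    have := h.2
    rw [hcount] at this
    omega

theorem IsMaximalLeftRE.not_disjoint {B R : Set ℕ} (hB : IsMaximalLeftRE B) (hinf : R.Infinite)
    (hR : ComputablePred fun n => n ∈ R) : ¬ Disjoint B R := by
  intro hBR
  obtain ⟨Q, hQR, hQ, hQinf, hRQ⟩ := exists_computable_split hR hinf
  refine hB.2.2 ⟨B ∪ Q, hB.1.union_of_disjoint hR hQ hQR hBR, ⟨?_, ?_⟩, ⟨by simp, ?_⟩⟩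
  · rw [Set.sdiff_eq_empty.2 Set.subset_union_left]
    exact Set.finite_empty
  · exact hQinf.mono fun x hx => ⟨Or.inr hx, fun h => Set.disjoint_left.1 hBR h (hQR hx)⟩
  · exact hRQ.mono fun x hx => ⟨trivial, fun h =>
      h.elim (fun h => Set.disjoint_left.1 hBR h hx.1) hx.2⟩

/-- An infinite recursively enumerable set has an infinite recursive subset. -/
theorem exists_infinite_computable_subset {p : ℕ → ℕ → Prop}
    (hp : ComputablePred fun x : ℕ × ℕ => p x.1 x.2) (hinf : {e | ∃ s, p e s}.Infinite) :
    ∃ R : Set ℕ, R.Infinite ∧ (ComputablePred fun n => n ∈ R) ∧ ∀ e ∈ R, ∃ s, p e s := by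
  have hex : ∃ f : ℕ → ℕ, Computable f ∧
      (∀ x, x < (f x).unpair.1 ∧ p (f x).unpair.1 (f x).unpair.2) ∧
      ∀ x w, (x < w.unpair.1 ∧ p w.unpair.1 w.unpair.2) → f x ≤ w := by
    have hw : Computable fun a : ℕ × ℕ => a.2.unpair := Computable.unpair.comp Computable.snd
    refine ComputablePred.exists_find
      (p := fun x w => x < w.unpair.1 ∧ p w.unpair.1 w.unpair.2)
      ((ComputablePred.nat_lt Computable.fst (Computable.fst.comp hw)).and (hp.comp hw))
      fun x => ?_
    obtain ⟨e, ⟨s, hs⟩, hxe⟩ := hinf.exists_gt x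
    exact ⟨Nat.pair e s, by simpa using ⟨hxe, hs⟩⟩
  obtain ⟨f, hf, hfp, -⟩ := hex
  let g : ℕ → ℕ := fun x => (f x).unpair.1
  have hg : Computable g := Computable.fst.comp (Computable.unpair.comp hf)
  -- Each value of `g` is a member of the r.e. set above its argument, so iterating gives a strictly
  -- increasing computable sequence with decidable range. The start `h 0 = 0` need not be a member,
  -- hence the shift to `h (n + 1)`.
  let h : ℕ → ℕ := fun n => Nat.rec (motive := fun _ => ℕ) 0 (fun _ c => g c) n
  have hh : Computable h := Computable.nat_rec (h := fun _ (x : ℕ × ℕ) => g x.2)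
    Computable.id (Computable.const 0) (hg.comp (Computable.snd.comp Computable.snd))
  have hmono : StrictMono h := strictMono_nat_of_lt_succ fun n => (hfp (h n)).1
  refine ⟨{x | ∃ n < x + 1, h (n + 1) = x}, ?_, ?_, ?_⟩
  · refine Set.infinite_of_injective_forall_mem (f := fun n => h (n + 1))
      (fun a b hab => by have : a + 1 = b + 1 := hmono.injective hab; omega) fun n => ⟨n, ?_, rfl⟩
    have := hmono.id_le (n + 1)
    simp only [id_eq] at this
    omega
  · exact ComputablePred.exists_lt (p := fun x n => h (n + 1) = x)
      (ComputablePred.nat_eq (hh.comp (Computable.succ.comp Computable.snd)) Computable.fst)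
      Computable.succ
  · rintro e ⟨n, -, rfl⟩
    exact ⟨_, (hfp (h n)).2⟩

theorem isLeftRE_Iic (z : ℕ) : IsLeftRE (Set.Iic z) :=
  ⟨fun _ => Set.Iic z, ComputablePred.nat_le Computable.snd (Computable.const z),
    fun _ => LexLE.refl _, IsPointwiseLimit.const _⟩

/-- Fix `y ∉ B`. An index with a stage above `B` on the first `y + 1` digits cannot name `B`, since
stages never exceed their limit. There are infinitely many such indices, as the sets `Set.Iic z`
with `z ≥ y` are distinct and all exceed `B` there. -/
theorem IsMaximalLeftRE.not_canBeMadeIntoItself {B : Set ℕ} (hB : IsMaximalLeftRE B) :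
    ¬ CanBeMadeIntoItself {B} := by
  rintro ⟨β, ⟨⟨S, hS, hmono, hlim⟩, huniv⟩, hself⟩
  obtain ⟨y, -, hy⟩ := hB.2.1.2.nonempty
  set c := prefixValue B (y + 1) with hc
  have hcomp : ComputablePred fun x : ℕ × ℕ => c < prefixValue (S x.1 x.2) (y + 1) :=
    ComputablePred.nat_lt (Computable.const c)
      (prefixValue.computable (S := fun x : ℕ × ℕ => S x.1 x.2)
        (hS.comp ((Computable.fst.comp Computable.fst).pair
          ((Computable.snd.comp Computable.fst).pair Computable.snd))) (Computable.const (y + 1)))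
  have hlarge : ∀ z, y ≤ z → c < prefixValue (Set.Iic z) (y + 1) := fun z hz => by
    have h1 : prefixValue (B ∩ Set.Iio y) y = prefixValue B y :=
      prefixValue.eq_iff.2 fun x hx => by simp [hx]
    have h2 := lexLE_iff.1 (LexLE.of_subset (A := B ∩ Set.Iio y) (B := Set.Iic z)
      fun x hx => (le_of_lt hx.2).trans hz) y
    rw [hc, prefixValue.succ_of_notMem hy, prefixValue.succ_of_mem (Set.mem_Iic.2 hz)]
    omega
  have hinf : {e | ∃ s, c < prefixValue (S e s) (y + 1)}.Infinite := by
    choose e he using fun z => huniv _ (isLeftRE_Iic z)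
    refine Set.infinite_of_injective_forall_mem (f := fun k => e (y + k)) (fun a b hab => ?_)
      fun k => ?_
    · have h := (he (y + a)).symm.trans ((congrArg β hab).trans (he (y + b)))
      have := Set.Iic_injective h
      omega
    · obtain ⟨s, hs⟩ := ((hlim (e (y + k))).eventually_prefixValue (y + 1)).exists
      refine ⟨s, ?_⟩
      rw [hs, he]
      exact hlarge _ (Nat.le_add_right _ _)
  obtain ⟨R, hRinf, hR, hRp⟩ := exists_infinite_computable_subset hcomp hinf
  refine hB.not_disjoint hRinf hR (Set.disjoint_left.2 fun e heB heR => ?_)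
  obtain ⟨s, hs⟩ := hRp e heR
  rw [← Set.mem_singleton_iff.1 hself] at heB
  have heq : β e = B := heB
  have := lexLE_iff.1 ((hlim e).lexLE (hmono e) s) (y + 1)
  rw [heq] at this
  omega

theorem mainTheorem6 :
    (∃ A : Set ℕ, IsMinimalLeftRE A ∧ CanBeMadeIntoItself {A}) ∧
    (¬ ∃ B : Set ℕ, IsMaximalLeftRE B ∧ CanBeMadeIntoItself {B}) ∧
    (¬ ∃ B R : Set ℕ, IsMaximalLeftRE B ∧ R.Infinite ∧ ComputablePred (fun n => n ∈ R) ∧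
      Disjoint B R) :=
  ⟨⟨minimalSet, isMinimalLeftRE_minimalSet, canBeMadeIntoItself_minimalSet⟩,
    fun ⟨_, hB, h⟩ => hB.not_canBeMadeIntoItself h,
    fun ⟨_, _, hB, hinf, hR, h⟩ => hB.not_disjoint hinf hR h⟩
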